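/- Let $a\in\mathbb R$. Let $D([0,\infty),\mathbb R)$ be the space of real-valued càdlàg functions on $[0,\infty)$ with the Skorokhod $J_1$ topology, induced by the metric $$d_{J_1}(f,g)=\sum_{m=1}^\infty 2^{-m}\big(1\wedge d_{J_1,m}(f|_m,g|_m)\big),\qquad d_{J_1,m}(x,y)=\inf_{\gamma}\Big\{\sup_{t\in[0,m]}|\gamma(t)-t|\ \vee\ \sup_{t\in[0,m]}|x(\gamma(t))-y(t)|\Big\},$$ where $\gamma$ ranges over the strictly increasing continuous bijections of $[0,m]$ onto itself and $f|_m(t)=\min\{1,\max\{0,m-t\}\}\,f(t)$ for $t\in[0,m]$. Let $\lambda$ be Lebesgue measure, and let $D_{a,\infty}$ be the subspace of those $f\in D([0,\infty),\mathbb R)$ with $\lambda(t\in[0,\infty): f(t)>a)=\infty$. The left fast-forwarding map at $a$ is the map $N_a:D_{a,\infty}\to D([0,\infty),\mathbb R)$, $N_a(f)=f\circ A_f^{-1}$, where $$A_f(t)=\int_0^t \mathbf 1_{\{f(z)>a\}}\,dz,\qquad A_f^{-1}(t)=\inf\{s>0: A_f(s)>t\}.$$ A path $f$ satisfies condition (Nl)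 if, whenever $\epsilon>0$ and $0\le t_1<t_2<t_3<t_4$ are such that $f(t)\ge a+\epsilon$ for all $t\in[t_1,t_2)\cup[t_3,t_4)$ and $f(t)\le a$ for all $t\in[t_2,t_3)$, one has $\sup\{f(t):t\in[t_2,t_3)\}<a$. **Theorem 3.1.** Let $f\in D_{a,\infty}$ with $f(0)>a$. Then $N_a$ is continuous at $f$ if and only if $f$ satisfies (Nl) and $\lambda(t\in[0,\infty): f(t)=a)=0$. -/

import Mathlib

open MeasureTheory Filter Topology
open scoped NNReal ENNReal

/-- The space `D([0,∞), ℝ)` of real-valued càdlàg paths. (At `t = 0` the condition on the left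
limit is void, as `𝓝[<] 0 = ⊥` in `ℝ≥0`.) -/
structure CadlagPath where
  toFun : ℝ≥0 → ℝ
  right_continuous : ∀ t, ContinuousWithinAt toFun (Set.Ici t) t
  left_limits : ∀ t, ∃ l, Tendsto toFun (𝓝[<] t) (𝓝 l)

instance : CoeFun CadlagPath (fun _ => ℝ≥0 → ℝ) := ⟨CadlagPath.toFun⟩

/-- The Skorokhod distance on `[0,T]`: the infimum of `‖γ - I‖ ∨ ‖x ∘ γ - y‖` (sup norms on `[0,T]`)
over the increasing bijections `γ` of `[0,T]`. An order isomorphism of `[0,T]` is the same as a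
strictly increasing continuous bijection. -/
noncomputable def skorokhodEDistOn (T : ℝ≥0) (x y : ℝ≥0 → ℝ) : ℝ≥0∞ :=
  ⨅ γ : Set.Icc (0 : ℝ≥0) T ≃o Set.Icc (0 : ℝ≥0) T,
    max (⨆ t, edist (γ t : ℝ≥0) (t : ℝ≥0)) (⨆ t, edist (x (γ t)) (y t))

/-- The weight that is `1` on `[0,m-1]`, equal to `m - t` for `t ∈ [m-1,m]`, and `0` afterwards. -/
noncomputable def cutoff (m : ℕ) (t : ℝ≥0) : ℝ := min 1 (max 0 ((m : ℝ) - t))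

/-- The smoothed restriction of `x` to `[0,m]`. -/
noncomputable def smoothRestrict (m : ℕ) (x : ℝ≥0 → ℝ) (t : ℝ≥0) : ℝ := cutoff m t * x t

/-- The Skorokhod `J₁` distance on `D([0,∞), ℝ)`:
`∑_{m ≥ 1} 2⁻ᵐ (1 ∧ d_m (f|_m, g|_m))`, with `f|_m`, `g|_m` the smoothed restrictions. -/
noncomputable def skorokhodEDist (f g : CadlagPath) : ℝ≥0∞ :=
  ∑' n : ℕ, (2⁻¹ : ℝ≥0∞) ^ (n + 1) *
    min 1 (skorokhodEDistOn ((n + 1 : ℕ) : ℝ≥0) (smoothRestrict (n + 1) f)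
      (smoothRestrict (n + 1) g))

theorem skorokhodEDistOn_self (T : ℝ≥0) (x : ℝ≥0 → ℝ) : skorokhodEDistOn T x x = 0 := by
  refine le_antisymm (iInf_le_of_le (OrderIso.refl _) ?_) zero_le
  simp

theorem skorokhodEDistOn_comm_le (T : ℝ≥0) (x y : ℝ≥0 → ℝ) :
    skorokhodEDistOn T x y ≤ skorokhodEDistOn T y x := by
  refine le_iInf fun γ => iInf_le_of_le γ.symm (max_le_max ?_ ?_)
  · refine iSup_le fun t => le_iSup_of_le (γ.symm t) ?_
    rw [OrderIso.apply_symm_apply, edist_comm]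
  · refine iSup_le fun t => le_iSup_of_le (γ.symm t) ?_
    rw [OrderIso.apply_symm_apply, edist_comm]

theorem skorokhodEDistOn_triangle (T : ℝ≥0) (x y z : ℝ≥0 → ℝ) :
    skorokhodEDistOn T x z ≤ skorokhodEDistOn T x y + skorokhodEDistOn T y z := by
  unfold skorokhodEDistOn
  refine ENNReal.le_iInf_add_iInf fun γ η => ?_
  refine iInf_le_of_le (η.trans γ) (max_le ?_ ?_)
  · refine iSup_le fun t => ?_
    refine (edist_triangle _ ((η t : Set.Icc (0 : ℝ≥0) T) : ℝ≥0) _).trans (add_le_add ?_ ?_)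
    · exact le_max_of_le_left (le_iSup (fun s => edist (γ s : ℝ≥0) (s : ℝ≥0)) (η t))
    · exact le_max_of_le_left (le_iSup (fun s => edist (η s : ℝ≥0) (s : ℝ≥0)) t)
  · refine iSup_le fun t => ?_
    refine (edist_triangle _ (y (η t)) _).trans (add_le_add ?_ ?_)
    · exact le_max_of_le_right (le_iSup (fun s => edist (x (γ s)) (y s)) (η t))
    · exact le_max_of_le_right (le_iSup (fun s => edist (y (η s)) (z s)) t)

/-- `D([0,∞), ℝ)` with the Skorokhod `J₁` metric; the induced topology is the `J₁` topology. -/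
noncomputable instance : PseudoEMetricSpace CadlagPath where
  edist := skorokhodEDist
  edist_self f := by simp [skorokhodEDist, skorokhodEDistOn_self]
  edist_comm f g := by
    have h : ∀ f g : CadlagPath, skorokhodEDist f g ≤ skorokhodEDist g f := fun f g =>
      ENNReal.tsum_le_tsum fun n => by
        gcongr
        exact skorokhodEDistOn_comm_le _ _ _
    exact le_antisymm (h f g) (h g f)
  edist_triangle f g h := by
    unfold skorokhodEDist
    rw [← ENNReal.tsum_add]
    refine ENNReal.tsum_le_tsum fun n => ?_
    rw [← mul_add]
    gcongr
    refine (min_le_min_left 1 (skorokhodEDistOn_triangle _ _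
      (smoothRestrict (n + 1) g) _)).trans ?_
    rcases le_total 1 (skorokhodEDistOn ((n + 1 : ℕ) : ℝ≥0) (smoothRestrict (n + 1) f)
      (smoothRestrict (n + 1) g)) with h1 | h1
    · exact (min_le_left _ _).trans (by rw [min_eq_left h1]; exact le_self_add)
    · rcases le_total 1 (skorokhodEDistOn ((n + 1 : ℕ) : ℝ≥0) (smoothRestrict (n + 1) g)
        (smoothRestrict (n + 1) h)) with h2 | h2
      · exact (min_le_left _ _).trans (by rw [min_eq_left h2]; exact le_add_self)
      · rw [min_eq_right h1, min_eq_right h2]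
        exact min_le_right _ _

/-- Lebesgue measure on `[0,∞)`. -/
noncomputable def leb : Measure ℝ≥0 := Measure.comap ((↑) : ℝ≥0 → ℝ) volume

/-- `D_{a,∞}([0,∞), ℝ)`: the càdlàg paths that spend infinite time above `a`, with the subspace
topology. -/
abbrev CadlagPathAbove (a : ℝ) : Type :=
  {f : CadlagPath // leb {t : ℝ≥0 | f t ∈ Set.Ioi a} = ∞}

/-- `A_f(t) = ∫₀ᵗ 1_{f(z) > a} dz`. -/
noncomputable def timeAbove (a : ℝ) (f : ℝ≥0 → ℝ) (t : ℝ≥0) : ℝ≥0∞ :=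
  ∫⁻ z in Set.Icc 0 t, {z | f z > a}.indicator 1 z ∂leb

/-- `A_f⁻¹(t) = inf {s > 0 : A_f(s) > t}`. -/
noncomputable def timeAboveInv (a : ℝ) (f : ℝ≥0 → ℝ) (t : ℝ≥0) : ℝ≥0 :=
  sInf {s : ℝ≥0 | 0 < s ∧ timeAbove a f s > t}

theorem CadlagPath.measurable (f : CadlagPath) : Measurable (f : ℝ≥0 → ℝ) := by
  have hm : ∀ n : ℕ, Measurable (fun t : ℝ≥0 => f ((⌊((n : ℝ≥0) + 1) * t⌋₊ + 1) / (n + 1))) := by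
    intro n
    have h1 : Measurable (fun t : ℝ≥0 => ⌊((n : ℝ≥0) + 1) * t⌋₊) :=
      Nat.measurable_floor.comp (measurable_id.const_mul _)
    exact (measurable_from_top (f := fun k : ℕ => f (((k : ℝ≥0) + 1) / (n + 1)))).comp h1
  refine measurable_of_tendsto_metrizable hm ?_
  rw [tendsto_pi_nhds]
  intro t
  have key : Tendsto (fun n : ℕ => ((⌊((n : ℝ≥0) + 1) * t⌋₊ : ℝ≥0) + 1) / (n + 1)) atTop
      (𝓝[≥] t) := by
    have hl : ∀ n : ℕ, t ≤ ((⌊((n : ℝ≥0) + 1) * t⌋₊ : ℝ≥0) + 1) / (n + 1) := by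
      intro n
      rw [le_div_iff₀ (by positivity), mul_comm]
      exact (Nat.lt_floor_add_one _).le
    have hu : ∀ n : ℕ, ((⌊((n : ℝ≥0) + 1) * t⌋₊ : ℝ≥0) + 1) / (n + 1)
        ≤ t + 1 / ((n : ℝ≥0) + 1) := by
      intro n
      have hn : (n : ℝ≥0) + 1 ≠ 0 := by positivity
      rw [div_le_iff₀ (by positivity), add_mul t, one_div, inv_mul_cancel₀ hn, mul_comm t]
      gcongr
      exact Nat.floor_le zero_le
    refine tendsto_nhdsWithin_iff.2 ⟨?_, Eventually.of_forall hl⟩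
    refine tendsto_of_tendsto_of_tendsto_of_le_of_le tendsto_const_nhds ?_ hl hu
    have h0 : Tendsto (fun n : ℕ => 1 / ((n : ℝ≥0) + 1)) atTop (𝓝 0) :=
      tendsto_one_div_add_atTop_nhds_zero_nat
    simpa using h0.const_add t
  exact (f.right_continuous t).tendsto.comp key

theorem timeAbove_mono (a : ℝ) (f : ℝ≥0 → ℝ) : Monotone (timeAbove a f) := fun _ _ h =>
  lintegral_mono_set (Set.Icc_subset_Icc_right h)

theorem leb_Ioc (s t : ℝ≥0) : leb (Set.Ioc s t) = ENNReal.ofReal (t - s) := by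
  have he : MeasurableEmbedding ((↑) : ℝ≥0 → ℝ) :=
    MeasurableEmbedding.subtype_coe (measurableSet_Ici (a := (0 : ℝ)))
  have hi : ((↑) : ℝ≥0 → ℝ) '' Set.Ioc s t = Set.Ioc (s : ℝ) t := by
    ext x
    constructor
    · rintro ⟨y, ⟨h1, h2⟩, rfl⟩
      exact ⟨by exact_mod_cast h1, by exact_mod_cast h2⟩
    · rintro ⟨h1, h2⟩
      exact ⟨⟨x, s.2.trans h1.le⟩, ⟨h1, h2⟩, rfl⟩
  rw [leb, he.comap_apply, hi, Real.volume_Ioc]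

theorem leb_singleton_zero : leb {0} = 0 := by
  have he : MeasurableEmbedding ((↑) : ℝ≥0 → ℝ) :=
    MeasurableEmbedding.subtype_coe (measurableSet_Ici (a := (0 : ℝ)))
  rw [leb, he.comap_apply, Set.image_singleton, Real.volume_singleton]

theorem timeAbove_zero (a : ℝ) (f : ℝ≥0 → ℝ) : timeAbove a f 0 = 0 := by
  rw [timeAbove, Set.Icc_self]
  exact setLIntegral_measure_zero _ _ leb_singleton_zero

theorem timeAbove_le (a : ℝ) (f : ℝ≥0 → ℝ) {s t : ℝ≥0} (h : s ≤ t) :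
    timeAbove a f t ≤ timeAbove a f s + ENNReal.ofReal (t - s) := by
  have hu : Set.Icc 0 t = Set.Icc 0 s ∪ Set.Ioc s t :=
    (Set.Icc_union_Ioc_eq_Icc zero_le h).symm
  rw [timeAbove, hu]
  refine (lintegral_union_le _ _ _).trans (add_le_add le_rfl ?_)
  refine (lintegral_indicator_one_le _).trans ((measure_mono (Set.subset_univ _)).trans ?_)
  rw [Measure.restrict_apply_univ, leb_Ioc]

theorem exists_timeAbove_gt {a : ℝ} (f : CadlagPathAbove a) (t : ℝ≥0) :
    ∃ s : ℝ≥0, 0 < s ∧ timeAbove a f.1 s > t := by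
  have hm : MeasurableSet {z : ℝ≥0 | f.1 z > a} := f.1.measurable measurableSet_Ioi
  have hA : ∀ s, timeAbove a f.1 s = leb ({z : ℝ≥0 | f.1 z > a} ∩ Set.Icc 0 s) := fun s => by
    rw [timeAbove, lintegral_indicator_one hm, Measure.restrict_apply hm]
  have hmono : Monotone fun n : ℕ => {z : ℝ≥0 | f.1 z > a} ∩ Set.Icc 0 (n : ℝ≥0) := by
    intro m n h
    exact Set.inter_subset_inter_right _ (Set.Icc_subset_Icc_right (by exact_mod_cast h))
  have hU : ⋃ n : ℕ, ({z : ℝ≥0 | f.1 z > a} ∩ Set.Icc 0 (n : ℝ≥0)) = {z | f.1 z > a} := by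
    ext z
    simp only [Set.mem_iUnion]
    refine ⟨fun ⟨_, h⟩ => h.1, fun h => ?_⟩
    obtain ⟨n, hn⟩ := exists_nat_ge z
    exact ⟨n, h, zero_le, hn⟩
  have hlim := tendsto_measure_iUnion_atTop (μ := leb) hmono
  have htop : leb {z : ℝ≥0 | f.1 z > a} = ∞ := f.2
  rw [hU, htop] at hlim
  obtain ⟨n, hn1, hn2⟩ := ((hlim.eventually (lt_mem_nhds (ENNReal.coe_lt_top (r := t)))).and
    (eventually_gt_atTop 0)).exists
  refine ⟨n, by exact_mod_cast hn2, ?_⟩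
  rw [hA]
  exact hn1

theorem timeAboveInv_strictMono {a : ℝ} (f : CadlagPathAbove a) :
    StrictMono (timeAboveInv a f.1) := by
  intro t t' h
  obtain ⟨s, hs⟩ := exists_timeAbove_gt f t'
  set d : ℝ≥0 := t' - t with hd
  have hdpos : 0 < d := tsub_pos_of_lt h
  refine lt_of_lt_of_le (b := timeAboveInv a f.1 t + d / 2) (lt_add_of_pos_right _ (by positivity)) ?_
  refine le_csInf ⟨s, hs⟩ fun r hr => ?_
  have hrd : d ≤ r := by
    by_contra! hlt
    have h1 := timeAbove_le a f.1 (zero_le (a := r))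
    rw [timeAbove_zero, zero_add] at h1
    have h2 : ENNReal.ofReal ((r : ℝ) - (0 : ℝ≥0)) = (r : ℝ≥0∞) := by simp
    rw [h2] at h1
    have h3 : (t' : ℝ≥0∞) < r := hr.2.trans_le h1
    have h4 : t' < r := by exact_mod_cast h3
    exact absurd (h4.trans hlt) (not_lt.2 tsub_le_self)
  have hmem : r - d / 2 ∈ {s : ℝ≥0 | 0 < s ∧ timeAbove a f.1 s > t} := by
    have hlt : d / 2 < r := (NNReal.half_lt_self hdpos.ne').trans_le hrd
    refine ⟨tsub_pos_of_lt hlt, ?_⟩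
    have h1 := timeAbove_le a f.1 (tsub_le_self : r - d / 2 ≤ r)
    have h2 : ((r : ℝ) - ((r - d / 2 : ℝ≥0) : ℝ)) = ((d / 2 : ℝ≥0) : ℝ) := by
      rw [NNReal.coe_sub hlt.le]; ring
    rw [h2, ENNReal.ofReal_coe_nnreal] at h1
    by_contra! hle
    have h3 : (t' : ℝ≥0∞) < ((t + d / 2 : ℝ≥0) : ℝ≥0∞) := by
      rw [ENNReal.coe_add]
      exact hr.2.trans_le (h1.trans (by gcongr))
    have h4 : t' < t + d / 2 := by exact_mod_cast h3
    have h5 : t + d = t' := add_tsub_cancel_of_le h.le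
    have h6 : t + d / 2 < t + d := by gcongr; exact NNReal.half_lt_self hdpos.ne'
    exact absurd (h4.trans h6) (by rw [h5]; exact lt_irrefl _)
  have h7 : timeAboveInv a f.1 t ≤ r - d / 2 := csInf_le (OrderBot.bddBelow _) hmem
  calc timeAboveInv a f.1 t + d / 2 ≤ r - d / 2 + d / 2 := by gcongr
    _ = r := tsub_add_cancel_of_le ((half_le_self zero_le).trans hrd)

theorem timeAboveInv_rightContinuous {a : ℝ} (f : CadlagPathAbove a) (t : ℝ≥0) :
    Tendsto (timeAboveInv a f.1) (𝓝[≥] t) (𝓝[≥] (timeAboveInv a f.1 t)) := by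
  have hmono := (timeAboveInv_strictMono f).monotone
  refine tendsto_nhdsWithin_iff.2 ⟨?_, eventually_nhdsWithin_of_forall fun s hs => hmono hs⟩
  refine tendsto_order.2 ⟨fun b hb => ?_, fun b hb => ?_⟩
  · exact eventually_nhdsWithin_of_forall fun s hs => hb.trans_le (hmono hs)
  · obtain ⟨s, hs⟩ := exists_timeAbove_gt f t
    obtain ⟨r, hr, hrb⟩ := exists_lt_of_csInf_lt ⟨s, hs⟩ hb
    have hev : ∀ᶠ u : ℝ≥0 in 𝓝 t, (u : ℝ≥0∞) < timeAbove a f.1 r :=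
      ENNReal.continuous_coe.tendsto t |>.eventually (gt_mem_nhds hr.2)
    filter_upwards [nhdsWithin_le_nhds hev] with u hu
    exact (csInf_le (OrderBot.bddBelow _) ⟨hr.1, hu⟩ : timeAboveInv a f.1 u ≤ r).trans_lt hrb

/-- The left fast-forwarding map at `a`, `f ↦ f ∘ A_f⁻¹`, from `D_{a,∞}` to `D([0,∞), ℝ)`. -/
noncomputable def leftFastForward (a : ℝ) (f : CadlagPathAbove a) : CadlagPath where
  toFun t := f.1 (timeAboveInv a f.1 t)
  right_continuous t :=
    (f.1.right_continuous (timeAboveInv a f.1 t)).tendsto.comp (timeAboveInv_rightContinuous f t)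
  left_limits t := by
    have hs := timeAboveInv_strictMono f
    rcases eq_or_ne (𝓝[<] t) ⊥ with h | h
    · exact ⟨0, by rw [h]; exact tendsto_bot⟩
    · have hlim := hs.monotone.tendsto_nhdsLT t
      obtain ⟨l, hl⟩ := f.1.left_limits (sSup (timeAboveInv a f.1 '' Set.Iio t))
      refine ⟨l, hl.comp (tendsto_nhdsWithin_iff.2 ⟨hlim, ?_⟩)⟩
      refine eventually_nhdsWithin_of_forall fun u hu => ?_
      obtain ⟨v, huv, hvt⟩ := exists_between (Set.mem_Iio.1 hu)
      refine (hs huv).trans_le (le_csSup ⟨timeAboveInv a f.1 t, ?_⟩ ⟨v, hvt, rfl⟩)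
      rintro _ ⟨w, hw, rfl⟩
      exact (hs (Set.mem_Iio.1 hw)).le

/-- Condition (Nl) at level `a`: whenever a stretch `[t₂,t₃)` on which `f ≤ a` is immediately
preceded and immediately followed by stretches on which `f ≥ a + ε`, the supremum of `f` over
`[t₂,t₃)` is strictly below `a`. -/
def ConditionNl (a : ℝ) (f : ℝ≥0 → ℝ) : Prop :=
  ∀ ε : ℝ, 0 < ε → ∀ t₁ t₂ t₃ t₄ : ℝ≥0, t₁ < t₂ → t₂ < t₃ → t₃ < t₄ →
    (∀ t ∈ Set.Ico t₁ t₂ ∪ Set.Ico t₃ t₄, a + ε ≤ f t) → (∀ t ∈ Set.Ico t₂ t₃, f t ≤ a) →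
      sSup (f '' Set.Ico t₂ t₃) < a

/-! The clock A_f is 1-Lipschitz, and A_f⁻¹(u) lies in [p,q) exactly when u lies in [A_f(p),
A_f(q)). Hence A_f⁻¹ carries Lebesgue measure to its restriction to {f > a} (`map_timeAboveInv`).

Necessity: test continuity along f + 1/(n+1), which lifts every point at level a just above it. If
the level set were not null, the fast-forwarded shifts would spend a fixed positive time at height a
+ 1/(n+1), although their limit is > a almost everywhere. If (Nl) fails, some stretch skipped by f
has supremum a, and the shifts retain points of it with value at most a + 1/(n+1), at times
converging to one around which the fast-forwarded f stays ≥ a + ε.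

Sufficiency: let γ_n match F_n with f. When the level set is null, A_{F_n}(γ_n s) → A_f(s)
(`tendsto_aboveTime`). Cut [0,K] into finitely many intervals of small oscillation, merge
consecutive low ones into excursions, and send [A_f(s), A_f(t)) affinely onto [A_{F_n}(γ_n s),
A_{F_n}(γ_n t)). Both fast-forwarded paths are nearly constant there, so only the end points matter.
The one obstruction is an excursion that f skips entirely but F_n might not: there f ≤ a, and (Nl)
forces F_n to skip it too (`exists_matched_of_chain`). -/

/-! ### Lebesgue measure on the half-line -/

theorem measurableEmbedding_coe_nnreal : MeasurableEmbedding ((↑) : ℝ≥0 → ℝ) :=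
  MeasurableEmbedding.subtype_coe (measurableSet_Ici (a := (0 : ℝ)))

theorem leb_singleton (t : ℝ≥0) : leb {t} = 0 := by
  rw [leb, measurableEmbedding_coe_nnreal.comap_apply, Set.image_singleton, Real.volume_singleton]

instance : NullSingletonClass leb := ⟨leb_singleton⟩

theorem leb_Ico {s t : ℝ≥0} (h : s ≤ t) : leb (Set.Ico s t) = (t - s : ℝ≥0) := by
  rw [measure_congr Ico_ae_eq_Ioc, leb_Ioc, ← NNReal.coe_sub h, ENNReal.ofReal_coe_nnreal]

instance : IsLocallyFiniteMeasure leb where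
  finiteAtNhds x := by
    refine ⟨Set.Ico 0 (x + 1), ?_, ?_⟩
    · refine mem_of_superset (Iio_mem_nhds (lt_add_of_pos_right x one_pos)) fun y hy => ?_
      exact ⟨zero_le, hy⟩
    · rw [leb_Ico zero_le]
      exact ENNReal.coe_lt_top

/-- The time spent above level `a` before time `t`, as a finite number. -/
noncomputable def aboveTime (a : ℝ) (h : CadlagPath) (t : ℝ≥0) : ℝ≥0 :=
  (timeAbove a h t).toNNReal

/-! ### The clock and its right-continuous inverse -/

section AboveTime

variable {a : ℝ} {h : CadlagPath}

theorem CadlagPath.measurableSet_above (a : ℝ) (h : CadlagPath) :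
    MeasurableSet {z : ℝ≥0 | a < h z} := h.measurable measurableSet_Ioi

theorem coe_aboveTime (a : ℝ) (h : CadlagPath) (t : ℝ≥0) :
    (aboveTime a h t : ℝ≥0∞) = timeAbove a h t := by
  refine ENNReal.coe_toNNReal (ne_of_lt ?_)
  have h1 := timeAbove_le a h (zero_le (a := t))
  rw [timeAbove_zero, zero_add] at h1
  exact h1.trans_lt ENNReal.ofReal_lt_top

theorem coe_aboveTime_eq_leb (a : ℝ) (h : CadlagPath) (t : ℝ≥0) :
    (aboveTime a h t : ℝ≥0∞) = leb ({z | a < h z} ∩ Set.Ico 0 t) := by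
  have e : timeAbove a h t = leb ({z | a < h z} ∩ Set.Icc 0 t) := by
    rw [timeAbove, lintegral_indicator_one (h.measurableSet_above a),
      Measure.restrict_apply (h.measurableSet_above a)]
  rw [coe_aboveTime, e]
  exact measure_congr ((ae_eq_refl _).inter Ico_ae_eq_Icc.symm)

theorem aboveTime_zero (a : ℝ) (h : CadlagPath) : aboveTime a h 0 = 0 := by
  simp [aboveTime, timeAbove_zero]

theorem aboveTime_mono (a : ℝ) (h : CadlagPath) : Monotone (aboveTime a h) := fun s t hst => by
  rw [← ENNReal.coe_le_coe, coe_aboveTime, coe_aboveTime]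
  exact timeAbove_mono a h hst

theorem aboveTime_eq_add {s t : ℝ≥0} (hst : s ≤ t) :
    (aboveTime a h t : ℝ≥0∞) = aboveTime a h s + leb ({z | a < h z} ∩ Set.Ico s t) := by
  rw [coe_aboveTime_eq_leb, coe_aboveTime_eq_leb, ← Set.Ico_union_Ico_eq_Ico zero_le hst,
    Set.inter_union_distrib_left, measure_union _ ((h.measurableSet_above a).inter measurableSet_Ico)]
  rw [Set.disjoint_left]
  exact fun x hx hx' => absurd hx.2.2 (not_lt.2 hx'.2.1)

theorem aboveTime_le_add {s t : ℝ≥0} (hst : s ≤ t) :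
    aboveTime a h t ≤ aboveTime a h s + (t - s) := by
  rw [← ENNReal.coe_le_coe, aboveTime_eq_add hst, ENNReal.coe_add]
  gcongr
  rw [← leb_Ico hst]
  exact measure_mono Set.inter_subset_right

theorem aboveTime_le_self (a : ℝ) (h : CadlagPath) (t : ℝ≥0) : aboveTime a h t ≤ t := by
  simpa [aboveTime_zero] using aboveTime_le_add (a := a) (h := h) (zero_le (a := t))

theorem aboveTime_eq_of_le {s t : ℝ≥0} (hst : s ≤ t) (H : ∀ r ∈ Set.Ico s t, h r ≤ a) :
    aboveTime a h t = aboveTime a h s := by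
  have e : {z | a < h z} ∩ Set.Ico s t = ∅ := by
    ext z
    simp only [Set.mem_inter_iff, Set.mem_ofPred_eq, Set.mem_empty_iff_false, iff_false]
    exact fun hz => absurd hz.1 (not_lt.2 (H z hz.2))
  have := aboveTime_eq_add (a := a) (h := h) hst
  rw [e, measure_empty, add_zero] at this
  exact_mod_cast this

theorem aboveTime_eq_add_of_lt {s t : ℝ≥0} (hst : s ≤ t) (H : ∀ r ∈ Set.Ico s t, a < h r) :
    aboveTime a h t = aboveTime a h s + (t - s) := by
  have := aboveTime_eq_add (a := a) (h := h) hst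
  rw [Set.inter_eq_right.2 (show Set.Ico s t ⊆ {z | a < h z} from H), leb_Ico hst] at this
  exact_mod_cast this

theorem CadlagPath.exists_forall_Ico (h : CadlagPath) {U : Set ℝ} (hU : IsOpen U) {r t : ℝ≥0}
    (hr : h r ∈ U) (hrt : r < t) : ∃ r', r < r' ∧ r' ≤ t ∧ ∀ z ∈ Set.Ico r r', h z ∈ U := by
  have h1 : ∀ᶠ z in 𝓝[≥] r, h z ∈ U := h.right_continuous r (hU.mem_nhds hr)
  obtain ⟨u, hu, hu'⟩ := (mem_nhdsGE_iff_exists_Ico_subset' hrt).1 h1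
  exact ⟨min u t, lt_min hu hrt, min_le_right _ _,
    fun z hz => hu' ⟨hz.1, hz.2.trans_le (min_le_left _ _)⟩⟩

theorem aboveTime_lt {s t r : ℝ≥0} (hr : r ∈ Set.Ico s t) (ha : a < h r) :
    aboveTime a h s < aboveTime a h t := by
  obtain ⟨r', h1, h2, h3⟩ := h.exists_forall_Ico isOpen_Ioi ha hr.2
  calc aboveTime a h s ≤ aboveTime a h r := aboveTime_mono a h hr.1
    _ < aboveTime a h r + (r' - r) := lt_add_of_pos_right _ (tsub_pos_of_lt h1)
    _ = aboveTime a h r' := (aboveTime_eq_add_of_lt h1.le h3).symm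
    _ ≤ aboveTime a h t := aboveTime_mono a h h2

theorem exists_lt_aboveTime (f : CadlagPathAbove a) (t : ℝ≥0) : ∃ s, t < aboveTime a f.1 s := by
  obtain ⟨s, -, hs⟩ := exists_timeAbove_gt f t
  rw [gt_iff_lt, ← coe_aboveTime] at hs
  exact ⟨s, by exact_mod_cast hs⟩

/-- The forward direction is the definition of the infimum; the converse needs the clock to exceed u
already strictly before q, which its Lipschitz bound provides. -/
theorem timeAboveInv_lt_iff (f : CadlagPathAbove a) {u q : ℝ≥0} :
    timeAboveInv a f.1 u < q ↔ u < aboveTime a f.1 q := by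
  constructor
  · intro hu
    obtain ⟨s, hs, hsq⟩ := exists_lt_of_csInf_lt (exists_timeAbove_gt f u) hu
    have h1 := hs.2
    rw [gt_iff_lt, ← coe_aboveTime] at h1
    exact lt_of_lt_of_le (by exact_mod_cast h1) (aboveTime_mono a f.1 hsq.le)
  · intro hu
    obtain ⟨d, hd, hd'⟩ := exists_between hu
    -- Going back from q by e costs the clock at most e, so it still reads at least d > u at q - e.
    set e := aboveTime a f.1 q - d with he
    have hepos : 0 < e := tsub_pos_of_lt hd'
    have heq : e < q := by
      refine lt_of_lt_of_le ?_ (aboveTime_le_self a f.1 q)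
      exact tsub_lt_self (zero_le.trans_lt hu) (zero_le.trans_lt hd)
    have hlt : q - e < q := tsub_lt_self (zero_le.trans_lt heq) hepos
    refine lt_of_le_of_lt (csInf_le (OrderBot.bddBelow _) ⟨tsub_pos_of_lt heq, ?_⟩) hlt
    rw [gt_iff_lt, ← coe_aboveTime, ENNReal.coe_lt_coe]
    refine hd.trans_le ?_
    have h1 := aboveTime_le_add (a := a) (h := f.1) hlt.le
    rw [tsub_tsub_cancel_of_le heq.le] at h1
    have h2 : d + e = aboveTime a f.1 q := add_tsub_cancel_of_le hd'.le
    rw [← h2] at h1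
    exact le_of_add_le_add_right h1

theorem le_timeAboveInv_iff (f : CadlagPathAbove a) {u p : ℝ≥0} :
    p ≤ timeAboveInv a f.1 u ↔ aboveTime a f.1 p ≤ u := by
  rw [← not_lt, timeAboveInv_lt_iff, not_lt]

theorem timeAboveInv_mem_Ico_iff (f : CadlagPathAbove a) {u p q : ℝ≥0} :
    timeAboveInv a f.1 u ∈ Set.Ico p q ↔ u ∈ Set.Ico (aboveTime a f.1 p) (aboveTime a f.1 q) := by
  rw [Set.mem_Ico, Set.mem_Ico, timeAboveInv_lt_iff, le_timeAboveInv_iff]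

theorem timeAboveInv_aboveTime (f : CadlagPathAbove a) {p : ℝ≥0} (hp : a < f.1 p) :
    timeAboveInv a f.1 (aboveTime a f.1 p) = p := by
  refine le_antisymm (le_of_forall_gt fun q hq => ?_) ((le_timeAboveInv_iff f).2 le_rfl)
  exact (timeAboveInv_lt_iff f).2 (aboveTime_lt ⟨le_rfl, hq⟩ hp)

/-- If f were below a at A_f⁻¹(u), it would stay below for a while by right continuity; the clock
would be flat there and A_f⁻¹(u) would come later. -/
theorem le_leftFastForward (f : CadlagPathAbove a) (u : ℝ≥0) : a ≤ leftFastForward a f u := by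
  change a ≤ f.1 (timeAboveInv a f.1 u)
  by_contra! hlt
  obtain ⟨r, h1, -, h3⟩ := f.1.exists_forall_Ico isOpen_Iio hlt
    (lt_add_of_pos_right (timeAboveInv a f.1 u) one_pos)
  have h4 := aboveTime_eq_of_le h1.le fun z hz => (h3 z hz).le
  refine absurd h1 (not_lt.2 ((le_timeAboveInv_iff f).2 ?_))
  rw [h4]
  exact (le_timeAboveInv_iff f).1 le_rfl

/-- Both measures give [p,q) the mass A_f(q) - A_f(p), and half-open intervals determine them. -/
theorem map_timeAboveInv (f : CadlagPathAbove a) :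
    leb.map (timeAboveInv a f.1) = leb.restrict {z | a < f.1 z} := by
  refine (Measure.ext_of_Ico _ _ fun p q hpq => ?_).symm
  rw [Measure.map_apply (timeAboveInv_strictMono f).monotone.measurable measurableSet_Ico,
    Measure.restrict_apply measurableSet_Ico]
  have e : timeAboveInv a f.1 ⁻¹' Set.Ico p q =
      Set.Ico (aboveTime a f.1 p) (aboveTime a f.1 q) := by
    ext u
    exact timeAboveInv_mem_Ico_iff f
  rw [e, leb_Ico (aboveTime_mono a f.1 hpq.le), ENNReal.coe_sub, aboveTime_eq_add hpq.le,
    ENNReal.add_sub_cancel_left ENNReal.coe_ne_top, Set.inter_comm]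

theorem ae_lt_leftFastForward (f : CadlagPathAbove a) :
    ∀ᵐ u ∂leb, a < leftFastForward a f u := by
  have h1 : ∀ᵐ z ∂(leb.map (timeAboveInv a f.1)), a < f.1 z := by
    rw [map_timeAboveInv]
    exact ae_restrict_mem (f.1.measurableSet_above a)
  exact ae_of_ae_map (timeAboveInv_strictMono f).monotone.measurable.aemeasurable h1

end AboveTime

/-! ### Extending, restricting and bending time changes -/

theorem exists_orderIso_extend {m : ℝ≥0} (e : Set.Icc (0 : ℝ≥0) m ≃o Set.Icc (0 : ℝ≥0) m) :
    ∃ γ : ℝ≥0 ≃o ℝ≥0, ∀ t : Set.Icc (0 : ℝ≥0) m, γ t = e t := by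
  let g : ℝ≥0 → ℝ≥0 := fun t => if h : t ≤ m then e ⟨t, zero_le, h⟩ else t
  have g1 : ∀ t (h : t ≤ m), g t = e ⟨t, zero_le, h⟩ := fun t h => dif_pos h
  have g2 : ∀ t, ¬ t ≤ m → g t = t := fun t h => dif_neg h
  have hmono : StrictMono g := by
    intro s t hst
    by_cases ht : t ≤ m
    · rw [g1 s (hst.le.trans ht), g1 t ht, Subtype.coe_lt_coe]
      exact e.strictMono hst
    · rw [g2 t ht]
      by_cases hs : s ≤ m
      · rw [g1 s hs]
        exact (e ⟨s, zero_le, hs⟩).2.2.trans_lt (not_le.1 ht)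
      · rwa [g2 s hs]
  have hsurj : Function.Surjective g := by
    intro y
    by_cases hy : y ≤ m
    · have hy' : y ∈ Set.Icc 0 m := ⟨zero_le, hy⟩
      refine ⟨e.symm ⟨y, hy'⟩, ?_⟩
      rw [g1 _ (e.symm ⟨y, hy'⟩).2.2]
      exact congrArg Subtype.val (e.apply_symm_apply ⟨y, hy'⟩)
    · exact ⟨y, g2 y hy⟩
  exact ⟨hmono.orderIsoOfSurjective g hsurj, fun t => g1 t t.2.2⟩

theorem exists_orderIso_restrict {m : ℝ≥0} (γ : ℝ≥0 ≃o ℝ≥0) (h : γ m = m) :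
    ∃ e : Set.Icc (0 : ℝ≥0) m ≃o Set.Icc (0 : ℝ≥0) m, ∀ t, (e t : ℝ≥0) = γ t := by
  have hsymm : γ.symm m = m := by rw [OrderIso.symm_apply_eq, h]
  let g : Set.Icc (0 : ℝ≥0) m → Set.Icc (0 : ℝ≥0) m :=
    fun t => ⟨γ t, zero_le, (γ.monotone t.2.2).trans_eq h⟩
  have hmono : StrictMono g := fun s t hst => γ.strictMono hst
  have hsurj : Function.Surjective g := fun y =>
    ⟨⟨γ.symm y, zero_le, (γ.symm.monotone y.2.2).trans_eq hsymm⟩, Subtype.ext (by simp [g])⟩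
  exact ⟨hmono.orderIsoOfSurjective g hsurj, fun t => rfl⟩

/-- A time change can be modified after time `T` so as to pass through a prescribed point; up to
that point its distance from the identity is controlled at the two end points. -/
theorem exists_orderIso_affine (γ : ℝ≥0 ≃o ℝ≥0) {T T' S' : ℝ≥0} (hT : T < T') (hS : γ T < S') :
    ∃ γ' : ℝ≥0 ≃o ℝ≥0, (∀ t ≤ T, γ' t = γ t) ∧ γ' T' = S' ∧
      ∀ ε : ℝ, dist (γ T) T ≤ ε → dist S' T' ≤ ε → ∀ t ∈ Set.Icc T T', dist (γ' t) t ≤ ε := by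
  set d : ℝ≥0 := T' - T with hd
  have hdpos : 0 < d := tsub_pos_of_lt hT
  have hTd : T + d = T' := add_tsub_cancel_of_le hT.le
  set c : ℝ≥0 := (S' - γ T) / d with hc
  have hcpos : 0 < c := div_pos (tsub_pos_of_lt hS) hdpos
  have hcd : γ T + c * d = S' := by
    rw [hc, div_mul_cancel₀ _ hdpos.ne', add_tsub_cancel_of_le hS.le]
  let g : ℝ≥0 → ℝ≥0 := fun t => γ (min t T) + c * (t - T)
  have g1 : ∀ t ≤ T, g t = γ t := fun t ht => by simp [g, ht, tsub_eq_zero_of_le ht]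
  have g2 : ∀ r, g (T + r) = γ T + c * r := fun r => by simp [g]
  have hmono : StrictMono g := by
    intro s t hst
    rcases lt_or_ge s T with hs | hs
    · exact add_lt_add_of_lt_of_le (γ.strictMono (by simp [hst, hs])) (by gcongr)
    · obtain ⟨r, rfl⟩ := exists_add_of_le hs
      obtain ⟨r', rfl⟩ := exists_add_of_le (hs.trans hst.le)
      rw [g2, g2]
      have : r < r' := lt_of_add_lt_add_left hst
      gcongr
  have hsurj : Function.Surjective g := by
    intro y
    rcases le_total y (γ T) with hy | hy
    · refine ⟨γ.symm y, ?_⟩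
      rw [g1 _ ((OrderIso.symm_apply_le γ).2 hy), OrderIso.apply_symm_apply]
    · refine ⟨T + (y - γ T) / c, ?_⟩
      rw [g2, mul_div_cancel₀ _ hcpos.ne', add_tsub_cancel_of_le hy]
  refine ⟨hmono.orderIsoOfSurjective g hsurj, g1, ?_, ?_⟩
  · change g T' = S'
    rw [← hTd, g2, hcd]
  · intro ε h1 h2 t ht
    change dist (g t) t ≤ ε
    obtain ⟨r, rfl⟩ := exists_add_of_le ht.1
    have hr : r ≤ d := by
      have := ht.2
      rw [← hTd] at this
      exact le_of_add_le_add_left this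
    rw [g2]
    rw [← hcd, ← hTd] at h2
    rw [NNReal.dist_eq, abs_le] at h1 h2 ⊢
    push_cast at h1 h2 ⊢
    have hr' : (r : ℝ) ≤ d := hr
    have hr0 : (0 : ℝ) ≤ r := r.2
    have hd0 : (0 : ℝ) < d := hdpos
    -- The displacement is affine in r, hence between its end values; the sign of c - 1 says in
    -- which direction it moves.
    constructor
    · rcases le_total (1 : ℝ) c with h | h <;> nlinarith
    · rcases le_total (1 : ℝ) c with h | h <;> nlinarith

/-- The time change `γ` matches `x` with `y` on `[0,K]` up to an error `ε`. -/
def SkorokhodClose (ε : ℝ) (K : ℝ≥0) (γ : ℝ≥0 ≃o ℝ≥0) (x y : ℝ≥0 → ℝ) : Prop :=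
  ∀ t ≤ K, dist (γ t) t ≤ ε ∧ dist (x (γ t)) (y t) ≤ ε

/-! ### Regularity of càdlàg paths -/

/-- The closure encodes a finite subdivision in a form suited to induction. The infimum of the
unreachable points is reachable by the left limit, and right continuity then leads beyond it. -/
theorem CadlagPath.exists_chain (f : CadlagPath) {ε : ℝ} (hε : 0 < ε) (K : ℝ≥0) :
    Relation.ReflTransGen (fun s t : ℝ≥0 => s < t ∧ ∀ r ∈ Set.Ico s t, |f r - f s| < ε) 0 K := by
  set R := Relation.ReflTransGen (fun s t : ℝ≥0 => s < t ∧ ∀ r ∈ Set.Ico s t, |f r - f s| < ε) 0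
    with hR
  by_contra hK
  set B : Set ℝ≥0 := {t | ¬ R t} with hB
  have hBne : B.Nonempty := ⟨K, hK⟩
  set c := sInf B with hc
  have hlt : ∀ t < c, R t := fun t ht => not_not.1 (notMem_of_lt_csInf ht (OrderBot.bddBelow _))
  have hRc : R c := by
    rcases eq_or_ne c 0 with h0 | h0
    · rw [h0]
    · obtain ⟨l, hl⟩ := f.left_limits c
      have h1 : ∀ᶠ r in 𝓝[<] c, |f r - l| < ε / 2 := by
        simpa [Real.dist_eq] using hl.eventually (Metric.ball_mem_nhds l (half_pos hε))
      obtain ⟨s, hs, hs'⟩ := (mem_nhdsLT_iff_exists_Ioo_subset' (pos_iff_ne_zero.2 h0)).1 h1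
      obtain ⟨s', hs1, hs2⟩ := exists_between (Set.mem_Iio.1 hs)
      refine (hlt s' hs2).tail ⟨hs2, fun r hr => ?_⟩
      have e1 : |f r - l| < ε / 2 := hs' ⟨hs1.trans_le hr.1, hr.2⟩
      have e2 : |f s' - l| < ε / 2 := hs' ⟨hs1, hs2⟩
      rw [abs_lt] at e1 e2 ⊢
      constructor <;> linarith
  have h2 : f c ∈ Metric.ball (f c) ε := Metric.mem_ball_self hε
  obtain ⟨c', h3, -, h4⟩ := f.exists_forall_Ico Metric.isOpen_ball h2 (lt_add_of_pos_right c one_pos)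
  refine absurd h3 (not_lt.2 (le_csInf hBne fun t ht => ?_))
  by_contra! htc
  rcases lt_trichotomy t c with h | h | h
  · exact ht (hlt t h)
  · exact ht (h ▸ hRc)
  · exact ht (hRc.tail ⟨h, fun r hr => by
      simpa [Real.dist_eq] using h4 r ⟨hr.1, hr.2.trans htc⟩⟩)

theorem CadlagPath.exists_bound (f : CadlagPath) (K : ℝ≥0) : ∃ R : ℝ, 0 ≤ R ∧ ∀ t ≤ K, |f t| ≤ R := by
  suffices h : ∃ R : ℝ, 0 ≤ R ∧ ∀ t < K + 1, |f t| ≤ R by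
    obtain ⟨R, h0, h1⟩ := h
    exact ⟨R, h0, fun t ht => h1 t (ht.trans_lt (lt_add_of_pos_right K one_pos))⟩
  have hchain := f.exists_chain one_pos (K + 1)
  generalize K + 1 = L at hchain ⊢
  induction hchain with
  | refl => exact ⟨0, le_rfl, fun t ht => absurd ht not_lt_zero⟩
  | @tail s t _ hst ih =>
    obtain ⟨R, h0, h1⟩ := ih
    refine ⟨max R (|f s| + 1), h0.trans (le_max_left _ _), fun r hr => ?_⟩
    rcases lt_or_ge r s with h | h
    · exact (h1 r h).trans (le_max_left _ _)
    · refine le_trans ?_ (le_max_right _ _)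
      have e := hst.2 r ⟨h, hr⟩
      have := abs_sub_abs_le_abs_sub (f r) (f s)
      linarith

/-- A rational between the left limit and the value makes a jump time left-isolated in a super- or
sublevel set, and every set has only countably many such points. -/
theorem CadlagPath.countable_not_continuousAt (f : CadlagPath) :
    {t | ¬ ContinuousAt f t}.Countable := by
  let S : Set ℝ≥0 → Set ℝ≥0 := fun s => {x ∈ s | 𝓝[s ∩ Set.Iio x] x = ⊥}
  have hS : ∀ s, (S s).Countable := fun s => countable_setOfPred_isolated_left_within
  refine (Set.countable_iUnion fun q : ℚ => (hS {t | (q : ℝ) ≤ f t}).union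
    (hS {t | f t ≤ (q : ℝ)})).mono fun t ht => ?_
  obtain ⟨l, hl⟩ := f.left_limits t
  have hne : l ≠ f t := by
    rintro rfl
    refine ht (continuousAt_iff_continuous_left'_right'.2
      ⟨hl, (f.right_continuous t).mono Set.Ioi_subset_Ici_self⟩)
  rw [Set.mem_iUnion]
  rcases lt_or_gt_of_ne hne with h | h
  · obtain ⟨q, hq1, hq2⟩ := exists_rat_btwn h
    refine ⟨q, Or.inl ⟨hq2.le, ?_⟩⟩
    have h1 : ∀ᶠ s in 𝓝[<] t, f s < q := hl.eventually (gt_mem_nhds hq1)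
    rw [Set.inter_comm, nhdsWithin_inter', ← disjoint_iff, disjoint_principal_right]
    filter_upwards [h1] with s hs using not_le.2 hs
  · obtain ⟨q, hq1, hq2⟩ := exists_rat_btwn h
    refine ⟨q, Or.inr ⟨hq1.le, ?_⟩⟩
    have h1 : ∀ᶠ s in 𝓝[<] t, (q : ℝ) < f s := hl.eventually (lt_mem_nhds hq2)
    rw [Set.inter_comm, nhdsWithin_inter', ← disjoint_iff, disjoint_principal_right]
    filter_upwards [h1] with s hs using not_le.2 hs

theorem CadlagPath.ae_continuousAt (f : CadlagPath) : ∀ᵐ t ∂leb, ContinuousAt f t :=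
  f.countable_not_continuousAt.measure_zero leb

/-! ### J₁ convergence as matching on compact intervals -/

theorem SkorokhodClose.exists_preimage {ε : ℝ} {K : ℝ≥0} {γ : ℝ≥0 ≃o ℝ≥0} {x y : ℝ≥0 → ℝ}
    (h : SkorokhodClose ε K γ x y) {t : ℝ≥0} (ht : (t : ℝ) + ε ≤ K) :
    γ.symm t ≤ K ∧ dist (γ.symm t) t ≤ ε ∧ dist (x t) (y (γ.symm t)) ≤ ε := by
  have h1 : γ.symm t ≤ K := by
    rw [OrderIso.symm_apply_le, ← NNReal.coe_le_coe]
    have := (h K le_rfl).1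
    rw [NNReal.dist_eq, abs_le] at this
    linarith
  have h2 := h _ h1
  rw [OrderIso.apply_symm_apply, dist_comm] at h2
  exact ⟨h1, h2⟩

theorem tendsto_apply_of_skorokhodClose {F : ℕ → ℝ≥0 → ℝ} {f : ℝ≥0 → ℝ} {K : ℝ≥0}
    {γ : ℕ → ℝ≥0 ≃o ℝ≥0} (h : ∀ ε > 0, ∀ᶠ n in atTop, SkorokhodClose ε K (γ n) (F n) f)
    {t : ℝ≥0} (ht : t < K) (hf : ContinuousAt f t) : Tendsto (fun n => F n t) atTop (𝓝 (f t)) := by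
  rw [Metric.tendsto_nhds]
  intro ε hε
  obtain ⟨δ, hδ, hδ'⟩ := Metric.continuousAt_iff.1 hf (ε / 2) (half_pos hε)
  have hKt : (0 : ℝ) < K - t := sub_pos.2 ht
  set η : ℝ := min (min (δ / 2) (ε / 2)) (K - t) with hη
  have hηpos : 0 < η := by positivity
  have e1 : η ≤ δ / 2 := (min_le_left _ _).trans (min_le_left _ _)
  have e2 : η ≤ ε / 2 := (min_le_left _ _).trans (min_le_right _ _)
  have e3 : η ≤ K - t := min_le_right _ _
  filter_upwards [h η hηpos] with n hn
  obtain ⟨-, h2, h3⟩ := hn.exists_preimage (t := t) (by linarith)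
  have h4 := hδ' (h2.trans_lt (by linarith))
  linarith [dist_triangle (F n t) (f ((γ n).symm t)) (f t)]

theorem cutoff_nonneg (m : ℕ) (t : ℝ≥0) : 0 ≤ cutoff m t := le_min zero_le_one (le_max_left _ _)

theorem cutoff_le_one (m : ℕ) (t : ℝ≥0) : cutoff m t ≤ 1 := min_le_left _ _

theorem cutoff_eq_one {m : ℕ} {t : ℝ≥0} (h : (t : ℝ) + 1 ≤ m) : cutoff m t = 1 :=
  min_eq_left (le_max_of_le_right (by linarith))

theorem cutoff_le {m : ℕ} {t : ℝ≥0} {ε : ℝ} (hε : 0 ≤ ε) (h : (m : ℝ) - t ≤ ε) : cutoff m t ≤ ε :=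
  (min_le_right _ _).trans (max_le hε h)

theorem abs_cutoff_sub_le (m : ℕ) (s t : ℝ≥0) : |cutoff m s - cutoff m t| ≤ dist s t := by
  unfold cutoff
  refine (abs_min_sub_min_le_max _ _ _ _).trans (max_le (by simp) ?_)
  refine (abs_max_sub_max_le_max _ _ _ _).trans (max_le (by simp) ?_)
  rw [NNReal.dist_eq, abs_sub_comm]
  exact le_of_eq (congrArg _ (by ring))

/-- The margin 2 keeps t and γ t below m - 1, where the cutoff is 1 and the smoothed restrictions
are the paths themselves. -/
theorem exists_orderIso_of_skorokhodEDistOn_lt {m : ℕ} {K : ℝ≥0} (hK : (K : ℝ) + 2 ≤ m) {ε : ℝ}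
    (hε : ε ≤ 1) {x y : ℝ≥0 → ℝ}
    (h : skorokhodEDistOn m (smoothRestrict m x) (smoothRestrict m y) < ENNReal.ofReal ε) :
    ∃ γ : ℝ≥0 ≃o ℝ≥0, SkorokhodClose ε K γ x y := by
  obtain ⟨e, he⟩ := iInf_lt_iff.1 h
  obtain ⟨γ, hγ⟩ := exists_orderIso_extend e
  have hε0 : 0 ≤ ε := (ENNReal.ofReal_pos.1 (zero_le.trans_lt h)).le
  refine ⟨γ, fun t ht => ?_⟩
  have htK : (t : ℝ) ≤ K := ht
  have htm : t ≤ (m : ℝ≥0) := by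
    rw [← NNReal.coe_le_coe, NNReal.coe_natCast]
    linarith
  set t' : Set.Icc (0 : ℝ≥0) m := ⟨t, ⟨zero_le, htm⟩⟩ with ht'
  have h1 : γ t = e t' := hγ t'
  have h2 : dist (γ t) t ≤ ε := by
    rw [h1, ← ENNReal.ofReal_le_ofReal_iff hε0, ← edist_dist]
    exact (le_iSup (fun s : Set.Icc (0 : ℝ≥0) m => edist (e s : ℝ≥0) (s : ℝ≥0)) t').trans
      ((le_max_left _ _).trans he.le)
  have h3 : dist (smoothRestrict m x (γ t)) (smoothRestrict m y t) ≤ ε := by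
    rw [h1, ← ENNReal.ofReal_le_ofReal_iff hε0, ← edist_dist]
    exact (le_iSup (fun s : Set.Icc (0 : ℝ≥0) m =>
      edist (smoothRestrict m x (e s)) (smoothRestrict m y s)) t').trans
      ((le_max_right _ _).trans he.le)
  refine ⟨h2, ?_⟩
  rw [NNReal.dist_eq, abs_le] at h2
  rwa [smoothRestrict, smoothRestrict, cutoff_eq_one (by linarith), cutoff_eq_one (by linarith),
    one_mul, one_mul] at h3

theorem exists_orderIso_of_tendsto {F : ℕ → CadlagPath} {f : CadlagPath}
    (h : Tendsto F atTop (𝓝 f)) (K : ℝ≥0) :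
    ∃ γ : ℕ → ℝ≥0 ≃o ℝ≥0, ∀ ε > 0, ∀ᶠ n in atTop, SkorokhodClose ε K (γ n) (F n) f := by
  obtain ⟨m, hm⟩ := exists_nat_ge ((K : ℝ) + 2)
  let D : ℕ → ℝ≥0∞ := fun n => skorokhodEDistOn ((m + 1 : ℕ) : ℝ≥0)
    (smoothRestrict (m + 1) (F n)) (smoothRestrict (m + 1) f)
  have hm' : (K : ℝ) + 2 ≤ (m + 1 : ℕ) := by push_cast; linarith
  have hD : ∀ ε : ℝ≥0∞, 0 < ε → ε ≤ 1 → ∀ᶠ n in atTop, D n < ε := by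
    intro ε hε hε1
    have hpow : (0 : ℝ≥0∞) < 2⁻¹ ^ (m + 1) := ENNReal.pow_pos (by simp) _
    have hpow' : (2⁻¹ : ℝ≥0∞) ^ (m + 1) ≠ ∞ := ENNReal.pow_ne_top (by simp)
    have h0 := (tendsto_iff_edist_tendsto_0.1 h).eventually
      (gt_mem_nhds (ENNReal.mul_pos hpow.ne' hε.ne'))
    filter_upwards [h0] with n hn
    have h1 : (2⁻¹ : ℝ≥0∞) ^ (m + 1) * min 1 (D n) ≤ edist (F n) f :=
      ENNReal.le_tsum (f := fun k : ℕ => (2⁻¹ : ℝ≥0∞) ^ (k + 1) *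
        min 1 (skorokhodEDistOn ((k + 1 : ℕ) : ℝ≥0) (smoothRestrict (k + 1) (F n))
          (smoothRestrict (k + 1) f))) m
    have h2 := (ENNReal.mul_lt_mul_iff_right hpow.ne' hpow').1 (h1.trans_lt hn)
    rcases min_lt_iff.1 h2 with h3 | h3
    · exact absurd hε1 (not_le.2 h3)
    · exact h3
  -- The infimum over time changes need not be attained; the vanishing slack 1/(n+1) lets a single γ
  -- serve all ε.
  have hex : ∀ n : ℕ, ∃ γ : ℝ≥0 ≃o ℝ≥0, ∀ ε : ℝ, ε ≤ 1 →
      D n + ENNReal.ofReal (1 / ((n : ℝ) + 1)) < ENNReal.ofReal ε → SkorokhodClose ε K γ (F n) f := by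
    intro n
    have hpos : (0 : ℝ≥0∞) < ENNReal.ofReal (1 / ((n : ℝ) + 1)) :=
      ENNReal.ofReal_pos.2 (by positivity)
    by_cases hc : D n + ENNReal.ofReal (1 / ((n : ℝ) + 1)) < ENNReal.ofReal 1
    · have hfin : D n + ENNReal.ofReal (1 / ((n : ℝ) + 1)) ≠ ∞ := (hc.trans ENNReal.ofReal_lt_top).ne
      have e1 : ENNReal.ofReal (D n + ENNReal.ofReal (1 / ((n : ℝ) + 1))).toReal =
        D n + ENNReal.ofReal (1 / ((n : ℝ) + 1)) := ENNReal.ofReal_toReal hfin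
      obtain ⟨γ, hγ⟩ := exists_orderIso_of_skorokhodEDistOn_lt (x := F n) (y := f) hm'
        (ε := (D n + ENNReal.ofReal (1 / ((n : ℝ) + 1))).toReal)
        (by
          have := hc.le
          rwa [← e1, ENNReal.ofReal_le_ofReal_iff zero_le_one] at this)
        (by
          rw [e1]
          exact ENNReal.lt_add_right (ENNReal.add_ne_top.1 hfin).1 hpos.ne')
      refine ⟨γ, fun ε hε hlt t ht => ?_⟩
      rw [← e1] at hlt
      have hle := (ENNReal.ofReal_lt_ofReal_iff_of_nonneg ENNReal.toReal_nonneg).1 hlt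
      exact ⟨(hγ t ht).1.trans hle.le, (hγ t ht).2.trans hle.le⟩
    · exact ⟨OrderIso.refl _, fun ε hε hlt =>
        absurd (hlt.trans_le (ENNReal.ofReal_le_ofReal hε)) hc⟩
  choose γ hγ using hex
  refine ⟨γ, fun ε hε => ?_⟩
  set η : ℝ := min ε 1 with hη
  have hηpos : 0 < η := lt_min hε one_pos
  have hη2 : ENNReal.ofReal (η / 2) ≤ 1 := by
    rw [← ENNReal.ofReal_one]
    exact ENNReal.ofReal_le_ofReal (by linarith [min_le_right ε 1])
  have hn1 := hD (ENNReal.ofReal (η / 2)) (ENNReal.ofReal_pos.2 (half_pos hηpos)) hη2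
  have hn2 : ∀ᶠ n : ℕ in atTop, 1 / ((n : ℝ) + 1) < η / 2 :=
    tendsto_one_div_add_atTop_nhds_zero_nat.eventually (gt_mem_nhds (half_pos hηpos))
  filter_upwards [hn1, hn2] with n h1 h2
  have h3 : D n + ENNReal.ofReal (1 / ((n : ℝ) + 1)) < ENNReal.ofReal η := by
    rw [← add_halves η, ENNReal.ofReal_add (half_pos hηpos).le (half_pos hηpos).le]
    exact ENNReal.add_lt_add h1 ((ENNReal.ofReal_lt_ofReal_iff (half_pos hηpos)).2 h2)
  intro t ht
  have h4 := hγ n η (min_le_right _ _) h3 t ht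
  exact ⟨h4.1.trans (min_le_left _ _), h4.2.trans (min_le_left _ _)⟩

/-- The given γ need not fix m. Since γ (m - 2ε) < m, it can be bent after m - 2ε so as to fix m; on
that last piece the cutoffs are at most 3ε and 2ε, so boundedness of the paths suffices there. -/
theorem skorokhodEDistOn_smoothRestrict_le {m : ℕ} (hm : 1 ≤ m) {ε R : ℝ} (hε : 0 < ε)
    (hε' : ε ≤ 1 / 4) (hR : 0 ≤ R) {γ : ℝ≥0 ≃o ℝ≥0} {x y : ℝ≥0 → ℝ} (hy : ∀ t ≤ (m : ℝ≥0) + 1, |y t| ≤ R)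
    (h : SkorokhodClose ε (m + 1) γ x y) :
    skorokhodEDistOn m (smoothRestrict m x) (smoothRestrict m y) ≤
      ENNReal.ofReal (5 * (R + 1) * ε) := by
  have hm' : (1 : ℝ) ≤ m := by exact_mod_cast hm
  set T : ℝ≥0 := ⟨m - 2 * ε, by linarith⟩ with hT
  have hTr : (T : ℝ) = m - 2 * ε := rfl
  have hTm : T < (m : ℝ≥0) := by
    rw [← NNReal.coe_lt_coe, hTr, NNReal.coe_natCast]
    linarith
  have hTm1 : T ≤ (m : ℝ≥0) + 1 := hTm.le.trans (le_add_of_nonneg_right zero_le)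
  have hγT := (h T hTm1).1
  have hγTm : γ T < (m : ℝ≥0) := by
    have := hγT
    rw [NNReal.dist_eq, abs_le] at this
    rw [← NNReal.coe_lt_coe, NNReal.coe_natCast]
    linarith
  obtain ⟨γ', h1, h2, h3⟩ := exists_orderIso_affine γ hTm hγTm
  obtain ⟨e, he⟩ := exists_orderIso_restrict γ' h2
  have hRε : 0 ≤ R * ε := mul_nonneg hR hε.le
  have hx : ∀ s ≤ (m : ℝ≥0), |x s| ≤ R + 1 := by
    intro s hs
    have hs' : (s : ℝ) ≤ m := by exact_mod_cast hs
    obtain ⟨e1, -, e2⟩ := h.exists_preimage (t := s) (by push_cast; linarith)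
    have e3 := hy _ e1
    rw [Real.dist_eq] at e2
    linarith [abs_sub_abs_le_abs_sub (x s) (y (γ.symm s))]
  refine iInf_le_of_le e (max_le (iSup_le fun t => ?_) (iSup_le fun t => ?_))
  · rw [he, edist_dist]
    refine ENNReal.ofReal_le_ofReal ?_
    have htm : (t : ℝ≥0) ≤ m := t.2.2
    have : dist (γ' t) t ≤ ε := by
      rcases le_total (t : ℝ≥0) T with ht | ht
      · rw [h1 t ht]
        exact (h t (ht.trans hTm1)).1
      · exact h3 ε hγT (by rw [dist_self]; exact hε.le) t ⟨ht, htm⟩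
    linarith
  · rw [he, edist_dist]
    refine ENNReal.ofReal_le_ofReal ?_
    have htm : (t : ℝ≥0) ≤ m := t.2.2
    have htm' : ((t : ℝ≥0) : ℝ) ≤ m := by exact_mod_cast htm
    have hyt := hy t (htm.trans (le_add_of_nonneg_right zero_le))
    rw [Real.dist_eq, smoothRestrict, smoothRestrict]
    rcases le_total (t : ℝ≥0) T with ht | ht
    · rw [h1 t ht]
      obtain ⟨e1, e2⟩ := h t (ht.trans hTm1)
      have e3 := (abs_cutoff_sub_le m (γ t) t).trans e1
      rw [Real.dist_eq] at e2
      have e4 : cutoff m (γ t) * x (γ t) - cutoff m t * y t =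
        cutoff m (γ t) * (x (γ t) - y t) + (cutoff m (γ t) - cutoff m t) * y t := by ring
      rw [e4]
      refine (abs_add_le _ _).trans ?_
      rw [abs_mul, abs_mul, abs_of_nonneg (cutoff_nonneg _ _)]
      have e5 : cutoff m (γ t) * |x (γ t) - y t| ≤ 1 * ε :=
        mul_le_mul (cutoff_le_one _ _) e2 (abs_nonneg _) zero_le_one
      have e6 : |cutoff m (γ t) - cutoff m t| * |y t| ≤ ε * R :=
        mul_le_mul e3 hyt (abs_nonneg _) hε.le
      linarith
    · have e1 := h3 ε hγT (by rw [dist_self]; exact hε.le) t ⟨ht, htm⟩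
      rw [NNReal.dist_eq, abs_le] at e1
      have ht' : (m : ℝ) - 2 * ε ≤ (t : ℝ≥0) := ht
      have e2 : γ' t ≤ (m : ℝ≥0) := (γ'.monotone htm).trans_eq h2
      have e3 := hx _ e2
      have c1 : cutoff m (γ' t) ≤ 3 * ε := cutoff_le (by linarith) (by linarith)
      have c2 : cutoff m t ≤ 2 * ε := cutoff_le (by linarith) (by linarith)
      refine (abs_sub _ _).trans ?_
      rw [abs_mul, abs_mul, abs_of_nonneg (cutoff_nonneg _ _), abs_of_nonneg (cutoff_nonneg _ _)]
      have e5 : cutoff m (γ' t) * |x (γ' t)| ≤ 3 * ε * (R + 1) :=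
        mul_le_mul c1 e3 (abs_nonneg _) (by linarith)
      have e6 : cutoff m t * |y t| ≤ 2 * ε * R :=
        mul_le_mul c2 hyt (abs_nonneg _) (by linarith)
      linarith

theorem tendsto_of_skorokhodClose {F : ℕ → CadlagPath} {f : CadlagPath}
    (h : ∀ (K : ℝ≥0) (ε : ℝ), 0 < ε → ∀ᶠ n in atTop, ∃ γ, SkorokhodClose ε K γ (F n) f) :
    Tendsto F atTop (𝓝 f) := by
  rw [tendsto_iff_edist_tendsto_0]
  let D : ℕ → ℕ → ℝ≥0∞ := fun n k => (2⁻¹ : ℝ≥0∞) ^ (k + 1) *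
    min 1 (skorokhodEDistOn ((k + 1 : ℕ) : ℝ≥0) (smoothRestrict (k + 1) (F n))
      (smoothRestrict (k + 1) f))
  have hD : ∀ n, edist (F n) f = ∫⁻ k, D n k ∂Measure.count := fun n => by
    rw [lintegral_count]; rfl
  simp_rw [hD]
  have h0 : ∫⁻ _ : ℕ, (0 : ℝ≥0∞) ∂Measure.count = 0 := lintegral_zero
  rw [← h0]
  -- The geometric weights dominate the series, so termwise convergence is enough.
  refine tendsto_lintegral_filter_of_dominated_convergence (fun k => (2⁻¹ : ℝ≥0∞) ^ (k + 1))
    (Eventually.of_forall fun n => measurable_from_top)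
    (Eventually.of_forall fun n => Eventually.of_forall fun k => ?_) ?_
    (Eventually.of_forall fun k => ?_)
  · exact mul_le_of_le_one_right' (min_le_left _ _)
  · rw [lintegral_count]
    have := ENNReal.tsum_geometric_add_one (2⁻¹ : ℝ≥0∞)
    rw [this]
    refine ENNReal.mul_ne_top (by simp) ?_
    rw [ENNReal.one_sub_inv_two, inv_inv]
    simp
  · obtain ⟨R, hR, hR'⟩ := f.exists_bound (((k + 1 : ℕ) : ℝ≥0) + 1)
    refine ENNReal.tendsto_nhds_zero.2 fun δ hδ => ?_
    obtain ⟨r, hr, hrδ⟩ : ∃ r : ℝ, 0 < r ∧ ENNReal.ofReal r ≤ δ := by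
      rcases eq_or_ne δ ∞ with h | h
      · exact ⟨1, one_pos, by simp [h]⟩
      · exact ⟨δ.toReal, ENNReal.toReal_pos hδ.ne' h, (ENNReal.ofReal_toReal h).le⟩
    set ε : ℝ := min (1 / 4) (r / (5 * (R + 1))) with hε
    have hεpos : 0 < ε := by positivity
    filter_upwards [h (((k + 1 : ℕ) : ℝ≥0) + 1) ε hεpos] with n hn
    obtain ⟨γ, hγ⟩ := hn
    have h1 := skorokhodEDistOn_smoothRestrict_le (Nat.le_add_left 1 k) hεpos (min_le_left _ _) hR hR' hγ
    have h2 : 5 * (R + 1) * ε ≤ r := by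
      have := min_le_right (1 / 4) (r / (5 * (R + 1)))
      rw [le_div_iff₀ (by positivity)] at this
      linarith
    calc D n k ≤ 1 * skorokhodEDistOn ((k + 1 : ℕ) : ℝ≥0) (smoothRestrict (k + 1) (F n))
          (smoothRestrict (k + 1) f) := by
          refine mul_le_mul' (pow_le_one' (by simp) _) (min_le_right _ _)
      _ ≤ δ := by
          rw [one_mul]
          exact h1.trans ((ENNReal.ofReal_le_ofReal h2).trans hrδ)

/-! ### Convergence of the clocks -/

theorem tendsto_orderIso_apply_of_skorokhodClose {F : ℕ → ℝ≥0 → ℝ} {f : ℝ≥0 → ℝ} {K : ℝ≥0}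
    {γ : ℕ → ℝ≥0 ≃o ℝ≥0} (h : ∀ ε > 0, ∀ᶠ n in atTop, SkorokhodClose ε K (γ n) (F n) f)
    {t : ℝ≥0} (ht : t ≤ K) : Tendsto (fun n => γ n t) atTop (𝓝 t) := by
  rw [Metric.tendsto_nhds]
  intro ε hε
  filter_upwards [h (ε / 2) (half_pos hε)] with n hn
  linarith [(hn t ht).1]

/-- Where f is continuous and differs from a, `F n` is eventually on the same side of a as f. Almost
every point is of this kind, so the indicators converge almost everywhere within a bounded window.
-/
theorem tendsto_aboveTime {a : ℝ} {F : ℕ → CadlagPath} {f : CadlagPath} {K : ℝ≥0}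
    {γ : ℕ → ℝ≥0 ≃o ℝ≥0} (h : ∀ ε > 0, ∀ᶠ n in atTop, SkorokhodClose ε K (γ n) (F n) f)
    (hnull : leb {t | f t = a} = 0) {s : ℝ≥0} (hs : s ≤ K) :
    Tendsto (fun n => aboveTime a (F n) (γ n s)) atTop (𝓝 (aboveTime a f s)) := by
  rw [← ENNReal.tendsto_coe]
  simp_rw [coe_aboveTime_eq_leb]
  have hγ := tendsto_orderIso_apply_of_skorokhodClose h hs
  refine tendsto_measure_of_ae_tendsto_indicator atTop
    ((f.measurableSet_above a).inter measurableSet_Ico)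
    (fun n => ((F n).measurableSet_above a).inter measurableSet_Ico)
    (measurableSet_Ico (a := 0) (b := s + 1)) ?_ ?_ ?_
  · rw [leb_Ico zero_le]
    exact ENNReal.coe_ne_top
  · filter_upwards [hγ.eventually (gt_mem_nhds (lt_add_of_pos_right s one_pos))] with n hn x hx
    exact ⟨hx.2.1, hx.2.2.trans hn⟩
  · have h1 : ∀ᵐ x ∂leb, f x ≠ a := by rw [ae_iff]; simpa using hnull
    have h2 : ∀ᵐ x ∂leb, x ≠ s := by rw [ae_iff]; simp
    filter_upwards [h1, h2, f.ae_continuousAt] with x hx1 hx2 hx3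
    rcases lt_or_gt_of_ne hx2 with hxs | hxs
    · have h3 := tendsto_apply_of_skorokhodClose h (hxs.trans_le hs) hx3
      have h4 := hγ.eventually (lt_mem_nhds hxs)
      rcases lt_or_gt_of_ne hx1 with hxa | hxa
      · filter_upwards [h3.eventually (gt_mem_nhds hxa)] with n hn
        exact iff_of_false (fun H => lt_asymm hn H.1) (fun H => lt_asymm hxa H.1)
      · filter_upwards [h3.eventually (lt_mem_nhds hxa), h4] with n hn hn'
        exact iff_of_true ⟨hn, zero_le, hn'⟩ ⟨hxa, zero_le, hxs⟩
    · filter_upwards [hγ.eventually (gt_mem_nhds hxs)] with n hn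
      exact iff_of_false (fun H => lt_asymm hn H.2.2) (fun H => lt_asymm hxs H.2.2)

/-- The path `f + c`. -/
def CadlagPath.addConst (f : CadlagPath) (c : ℝ) : CadlagPath where
  toFun t := f t + c
  right_continuous t := (f.right_continuous t).add continuousWithinAt_const
  left_limits t := by
    obtain ⟨l, hl⟩ := f.left_limits t
    exact ⟨l + c, hl.add_const c⟩

/-- The path `f + 1 / (n + 1)`. -/
noncomputable def CadlagPathAbove.shift {a : ℝ} (f : CadlagPathAbove a) (n : ℕ) :
    CadlagPathAbove a :=
  ⟨f.1.addConst (1 / ((n : ℝ) + 1)), by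
    have h := f.2
    rw [← top_le_iff] at h ⊢
    refine h.trans (measure_mono fun t (ht : a < f.1 t) => ?_)
    have : (0 : ℝ) < 1 / ((n : ℝ) + 1) := by positivity
    exact (by linarith : a < f.1 t + 1 / ((n : ℝ) + 1))⟩

/-! ### Necessity: testing continuity on upward shifts -/

section Necessity

variable {a : ℝ} (f : CadlagPathAbove a)

theorem CadlagPathAbove.shift_apply (n : ℕ) (t : ℝ≥0) :
    (f.shift n).1 t = f.1 t + 1 / ((n : ℝ) + 1) := rfl

theorem CadlagPathAbove.lt_shift (n : ℕ) (t : ℝ≥0) : f.1 t < (f.shift n).1 t := by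
  rw [f.shift_apply]
  exact lt_add_of_pos_right _ (by positivity)

theorem skorokhodClose_shift (K : ℝ≥0) {ε : ℝ} (hε : 0 < ε) :
    ∀ᶠ n in atTop, SkorokhodClose ε K (OrderIso.refl _) (f.shift n).1 f.1 := by
  filter_upwards [tendsto_one_div_add_atTop_nhds_zero_nat.eventually (gt_mem_nhds hε)] with n hn
  intro t _
  have h0 : (0 : ℝ) < 1 / ((n : ℝ) + 1) := by positivity
  refine ⟨by simpa using hε.le, ?_⟩
  rw [OrderIso.refl_apply, f.shift_apply, Real.dist_eq, add_sub_cancel_left, abs_of_pos h0]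
  exact hn.le

theorem tendsto_shift : Tendsto f.shift atTop (𝓝 f) :=
  tendsto_subtype_rng.2 (tendsto_of_skorokhodClose fun K _ hε =>
    (skorokhodClose_shift f K hε).mono fun _ hn => ⟨_, hn⟩)

variable {f}

theorem leb_level_eq_zero_of_continuousAt (hc : ContinuousAt (leftFastForward a) f) :
    leb {t : ℝ≥0 | f.1 t = a} = 0 := by
  have hlim : Tendsto (fun n => leftFastForward a (f.shift n)) atTop (𝓝 (leftFastForward a f)) :=
    hc.tendsto.comp (tendsto_shift f)
  have hmeas : MeasurableSet {t : ℝ≥0 | f.1 t = a} := f.1.measurable (measurableSet_singleton a)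
  suffices H : ∀ k : ℕ, leb ({t : ℝ≥0 | f.1 t = a} ∩ Set.Ico 0 (k : ℝ≥0)) = 0 by
    refine measure_mono_null (fun t ht => ?_) (measure_iUnion_null H)
    obtain ⟨k, hk⟩ := exists_nat_gt t
    exact Set.mem_iUnion.2 ⟨k, ht, zero_le, hk⟩
  intro k
  set C := {t : ℝ≥0 | f.1 t = a} ∩ Set.Ico 0 (k : ℝ≥0) with hC
  have hCm : MeasurableSet C := hmeas.inter measurableSet_Ico
  obtain ⟨γ, hγ⟩ := exists_orderIso_of_tendsto hlim (k : ℝ≥0)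
  have hmT : ∀ n, Measurable (timeAboveInv a (f.shift n).1) :=
    fun n => (timeAboveInv_strictMono (f.shift n)).monotone.measurable
  -- The shifted path is above a on all of C, so its clock counts C in full, for every n.
  have hE : ∀ n, leb (timeAboveInv a (f.shift n).1 ⁻¹' C) = leb C := by
    intro n
    rw [← Measure.map_apply (hmT n) hCm, map_timeAboveInv, Measure.restrict_apply hCm]
    refine congrArg leb (Set.inter_eq_left.2 fun t ht => ?_)
    have h1 : f.1 t = a := ht.1
    exact h1.symm.trans_lt (f.lt_shift n t)
  have hsub : ∀ n, timeAboveInv a (f.shift n).1 ⁻¹' C ⊆ Set.Ico 0 (k : ℝ≥0) := fun n u hu =>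
    ⟨zero_le, ((timeAboveInv_lt_iff (f.shift n)).1 hu.2.2).trans_le (aboveTime_le_self _ _ _)⟩
  have key : Tendsto (fun n => leb (timeAboveInv a (f.shift n).1 ⁻¹' C)) atTop (𝓝 (leb ∅)) := by
    refine tendsto_measure_of_ae_tendsto_indicator atTop MeasurableSet.empty
      (fun n => hmT n hCm) (measurableSet_Ico (a := 0) (b := (k : ℝ≥0))) ?_
      (Eventually.of_forall hsub) ?_
    · rw [leb_Ico zero_le]
      exact ENNReal.coe_ne_top
    · filter_upwards [ae_lt_leftFastForward f, (leftFastForward a f).ae_continuousAt] with u hu huc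
      rcases lt_or_ge u (k : ℝ≥0) with huk | huk
      · have h1 := tendsto_apply_of_skorokhodClose hγ huk huc
        have h2 := tendsto_one_div_add_atTop_nhds_zero_nat (𝕜 := ℝ)
        have h3 := h1.sub h2
        rw [sub_zero] at h3
        filter_upwards [h3.eventually (lt_mem_nhds hu)] with n hn
        refine iff_of_false (fun H => ?_) (Set.notMem_empty u)
        have h4 : f.1 (timeAboveInv a (f.shift n).1 u) = a := H.1
        have h5 : leftFastForward a (f.shift n) u = a + 1 / ((n : ℝ) + 1)  :=
          congrArg (· + 1 / ((n : ℝ) + 1)) h4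
        rw [h5] at hn
        linarith
      · exact Eventually.of_forall fun n =>
          iff_of_false (fun H => absurd (hsub n H).2 (not_lt.2 huk)) (Set.notMem_empty u)
  simp_rw [hE] at key
  rw [measure_empty] at key
  exact tendsto_nhds_unique tendsto_const_nhds key

theorem le_leftFastForward_of_forall_Ico {b : ℝ} {p q u : ℝ≥0} (H : ∀ t ∈ Set.Ico p q, b ≤ f.1 t)
    (hu : u ∈ Set.Ico (aboveTime a f.1 p) (aboveTime a f.1 q)) : b ≤ leftFastForward a f u :=
  H _ ((timeAboveInv_mem_Ico_iff f).2 hu)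

theorem conditionNl_of_continuousAt (hc : ContinuousAt (leftFastForward a) f) :
    ConditionNl a f.1 := by
  intro ε hε t₁ t₂ t₃ t₄ h12 h23 h34 hhigh hlow
  have hnull := leb_level_eq_zero_of_continuousAt hc
  have hlim : Tendsto (fun n => leftFastForward a (f.shift n)) atTop (𝓝 (leftFastForward a f)) :=
    hc.tendsto.comp (tendsto_shift f)
  by_contra! hsup
  -- At these points the shifted path exceeds a, by at most 1/(n+1), so fast-forwarding keeps them.
  have hp : ∀ n : ℕ, ∃ p ∈ Set.Ico t₂ t₃, a - 1 / ((n : ℝ) + 1) < f.1 p := by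
    intro n
    have h0 : (0 : ℝ) < 1 / ((n : ℝ) + 1) := by positivity
    have hne : (f.1 '' Set.Ico t₂ t₃).Nonempty := ⟨_, t₂, ⟨le_rfl, h23⟩, rfl⟩
    obtain ⟨_, ⟨p, hp, rfl⟩, hp'⟩ := exists_lt_of_lt_csSup hne
      (show a - 1 / ((n : ℝ) + 1) < sSup (f.1 '' Set.Ico t₂ t₃) by linarith)
    exact ⟨p, hp, hp'⟩
  choose p hp hpa using hp
  set u : ℕ → ℝ≥0 := fun n => aboveTime a (f.shift n).1 (p n) with hu
  have hval : ∀ n, leftFastForward a (f.shift n) (u n) ≤ a + 1 / ((n : ℝ) + 1) := by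
    intro n
    have h1 : a < (f.shift n).1 (p n) := by
      rw [f.shift_apply]; linarith [hpa n]
    change (f.shift n).1 (timeAboveInv a (f.shift n).1 (u n)) ≤ _
    rw [hu, timeAboveInv_aboveTime _ h1, f.shift_apply]
    linarith [hlow _ (hp n)]
  have hA : ∀ s, Tendsto (fun n => aboveTime a (f.shift n).1 s) atTop (𝓝 (aboveTime a f.1 s)) :=
    fun s => tendsto_aboveTime (γ := fun _ => OrderIso.refl _)
      (fun ε hε => skorokhodClose_shift f s hε) hnull le_rfl
  have h3 : aboveTime a f.1 t₃ = aboveTime a f.1 t₂ := aboveTime_eq_of_le h23.le hlow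
  have hulim : Tendsto u atTop (𝓝 (aboveTime a f.1 t₂)) := by
    refine tendsto_of_tendsto_of_tendsto_of_le_of_le (hA t₂) (h3 ▸ hA t₃)
      (fun n => aboveTime_mono _ _ (hp n).1) (fun n => aboveTime_mono _ _ (hp n).2.le)
  have hAlt : aboveTime a f.1 t₁ < aboveTime a f.1 t₂ :=
    aboveTime_lt ⟨le_rfl, h12⟩ (by linarith [hhigh t₁ (Or.inl ⟨le_rfl, h12⟩)])
  have hAlt' : aboveTime a f.1 t₂ < aboveTime a f.1 t₄ := h3 ▸
    aboveTime_lt ⟨le_rfl, h34⟩ (by linarith [hhigh t₃ (Or.inr ⟨le_rfl, h34⟩)])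
  have hnear : ∀ w ∈ Set.Ioo (aboveTime a f.1 t₁) (aboveTime a f.1 t₄),
      a + ε ≤ leftFastForward a f w := by
    intro w hw
    rcases lt_or_ge w (aboveTime a f.1 t₂) with h | h
    · exact le_leftFastForward_of_forall_Ico (fun t ht => hhigh t (Or.inl ht)) ⟨hw.1.le, h⟩
    · exact le_leftFastForward_of_forall_Ico (fun t ht => hhigh t (Or.inr ht)) ⟨h3 ▸ h, hw.2⟩
  -- The 2 covers u n < A_f(t₂) + 1 and a matching error of at most 1.
  obtain ⟨γ, hγ⟩ := exists_orderIso_of_tendsto hlim (aboveTime a f.1 t₂ + 2)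
  have hwlim : Tendsto (fun n => (γ n).symm (u n)) atTop (𝓝 (aboveTime a f.1 t₂)) := by
    refine (tendsto_iff_of_dist ?_).1 hulim
    rw [Metric.tendsto_nhds]
    intro δ hδ
    set η : ℝ := min (δ / 2) 1 with hη
    filter_upwards [hγ η (by positivity),
      hulim.eventually (gt_mem_nhds (lt_add_of_pos_right _ one_pos))] with n hn hn'
    have hn'' : (u n : ℝ) < aboveTime a f.1 t₂ + 1 := hn'
    have h1 := (hn.exists_preimage (t := u n) (by
      push_cast; linarith [min_le_right (δ / 2) 1])).2.1
    rw [dist_zero_right, Real.norm_of_nonneg dist_nonneg, dist_comm]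
    linarith [min_le_left (δ / 2) 1]
  have e1 : ∀ᶠ n in atTop, a + ε ≤ leftFastForward a f ((γ n).symm (u n)) :=
    (hwlim.eventually (Ioo_mem_nhds hAlt hAlt')).mono fun n hn => hnear _ hn
  have e2 : ∀ᶠ n : ℕ in atTop, 1 / ((n : ℝ) + 1) < ε / 2 :=
    tendsto_one_div_add_atTop_nhds_zero_nat.eventually (gt_mem_nhds (half_pos hε))
  set η : ℝ := min (ε / 4) 1 with hη
  obtain ⟨n, n1, n2, n3, n4⟩ := (e1.and (e2.and ((hγ η (by positivity)).and
    (hulim.eventually (gt_mem_nhds (lt_add_of_pos_right _ one_pos)))))).exists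
  have n5 : (u n : ℝ) < aboveTime a f.1 t₂ + 1 := n4
  have n6 := (n3.exists_preimage (t := u n) (by
    push_cast; linarith [min_le_right (ε / 4) 1])).2.2
  rw [Real.dist_eq, abs_le] at n6
  linarith [hval n, min_le_left (ε / 4) 1, n6.1]

end Necessity

/-- There is a time change mapping `[0,T)` onto `[0,S)` and matching `x` with `y` there up to an
error `δ`. -/
def MatchedUpTo (δ : ℝ) (T S : ℝ≥0) (x y : ℝ≥0 → ℝ) : Prop :=
  ∃ η : ℝ≥0 ≃o ℝ≥0, η T = S ∧ ∀ t < T, dist (η t) t ≤ δ ∧ dist (x (η t)) (y t) ≤ δ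

/-- On the new piece every value of x is close to every value of y, so any bijection would match
them; the affine one has its displacement controlled by the end points. -/
theorem MatchedUpTo.extend {δ : ℝ} {T S T' S' : ℝ≥0} {x y : ℝ≥0 → ℝ} (h : MatchedUpTo δ T S x y)
    (hT : T < T') (hS : S < S') (hd : dist S T ≤ δ) (hd' : dist S' T' ≤ δ)
    (hxy : ∀ t ∈ Set.Ico T T', ∀ s ∈ Set.Ico S S', dist (x s) (y t) ≤ δ) :
    MatchedUpTo δ T' S' x y := by
  obtain ⟨η, rfl, h2⟩ := h
  obtain ⟨η', h3, h4, h5⟩ := exists_orderIso_affine η hT hS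
  refine ⟨η', h4, fun t ht => ?_⟩
  rcases lt_or_ge t T with h | h
  · rw [h3 t h.le]
    exact h2 t h
  · refine ⟨h5 δ hd hd' t ⟨h, ht.le⟩, hxy t ⟨h, ht⟩ _ ⟨?_, ?_⟩⟩
    · rw [← h3 T le_rfl]
      exact η'.monotone h
    · rw [← h4]
      exact η'.strictMono ht

/-! ### Sufficiency: matching the fast-forwarded paths piece by piece -/

section Sufficiency

variable {a : ℝ} {f : CadlagPathAbove a} {F : ℕ → CadlagPathAbove a} {K : ℝ≥0}
  {γ : ℕ → ℝ≥0 ≃o ℝ≥0}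

/-- In a low excursion f may drop far below `lo`, but fast-forwarded values are at least a; hence
the alternative `lo ≤ a`. The band of width 4ε plus the matching error gives 5ε. -/
theorem dist_leftFastForward_le {g : CadlagPathAbove a} {η : ℝ≥0 ≃o ℝ≥0} {ε lo : ℝ} (hε : 0 < ε)
    (h : SkorokhodClose ε K η g.1 f.1) {s t : ℝ≥0} (ht : t ≤ K)
    (hlo : lo ≤ a ∨ ∀ r ∈ Set.Ico s t, lo ≤ f.1 r) (hhi : ∀ r ∈ Set.Ico s t, f.1 r ≤ lo + 4 * ε)
    {u v : ℝ≥0} (hu : u ∈ Set.Ico (aboveTime a f.1 s) (aboveTime a f.1 t))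
    (hv : v ∈ Set.Ico (aboveTime a g.1 (η s)) (aboveTime a g.1 (η t))) :
    dist (leftFastForward a g v) (leftFastForward a f u) ≤ 5 * ε := by
  have hu1 := (timeAboveInv_mem_Ico_iff f).2 hu
  have hv1 := (timeAboveInv_mem_Ico_iff g).2 hv
  have hu2 : a ≤ leftFastForward a f u := le_leftFastForward f u
  have hv2 : a ≤ leftFastForward a g v := le_leftFastForward g v
  have hu3 : leftFastForward a f u ≤ lo + 4 * ε := hhi _ hu1
  have hr1 : η.symm (timeAboveInv a g.1 v) ∈ Set.Ico s t :=
    ⟨(OrderIso.le_symm_apply η).2 hv1.1, (OrderIso.symm_apply_lt η).2 hv1.2⟩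
  have hr2 : dist (g.1 (timeAboveInv a g.1 v)) (f.1 (η.symm (timeAboveInv a g.1 v))) ≤ ε := by
    have := (h _ (hr1.2.le.trans ht)).2
    rwa [OrderIso.apply_symm_apply] at this
  have hr3 : dist (leftFastForward a g v) (f.1 (η.symm (timeAboveInv a g.1 v))) ≤ ε := hr2
  have hr4 := hhi _ hr1
  rw [Real.dist_eq, abs_le] at hr3 ⊢
  rcases hlo with hlo | hlo
  · constructor <;> linarith
  · have hr5 := hlo _ hr1
    have hu4 : lo ≤ leftFastForward a f u := hlo _ hu1
    constructor <;> linarith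

theorem eventually_matchedUpTo_extend
    (h : ∀ ε > 0, ∀ᶠ n in atTop, SkorokhodClose ε K (γ n) (F n).1 f.1)
    (hnull : leb {t : ℝ≥0 | f.1 t = a} = 0) {ε lo : ℝ} (hε : 0 < ε) {s t : ℝ≥0} (hst : s ≤ t)
    (ht : t ≤ K) (hA : aboveTime a f.1 s < aboveTime a f.1 t)
    (hlo : lo ≤ a ∨ ∀ r ∈ Set.Ico s t, lo ≤ f.1 r) (hhi : ∀ r ∈ Set.Ico s t, f.1 r ≤ lo + 4 * ε)
    (hs : ∀ᶠ n in atTop, MatchedUpTo (5 * ε) (aboveTime a f.1 s) (aboveTime a (F n).1 (γ n s))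
      (leftFastForward a (F n)) (leftFastForward a f)) :
    ∀ᶠ n in atTop, MatchedUpTo (5 * ε) (aboveTime a f.1 t) (aboveTime a (F n).1 (γ n t))
      (leftFastForward a (F n)) (leftFastForward a f) := by
  have hAs := tendsto_aboveTime h hnull (hst.trans ht)
  have hAt := tendsto_aboveTime h hnull ht
  have h5 : 0 < 5 * ε := by positivity
  filter_upwards [hs, h ε hε, hAs.eventually_lt hAt hA,
    hAs.eventually (Metric.closedBall_mem_nhds _ h5),
    hAt.eventually (Metric.closedBall_mem_nhds _ h5)] with n h1 h2 h3 h4 h5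
  exact h1.extend hA h3 h4 h5 fun u hu v hv => dist_leftFastForward_le hε h2 ht hlo hhi hu hv

/-- The gap between the supremum and a absorbs the matching error, so `F n` does not exceed a on the
image interval either. -/
theorem eventually_aboveTime_eq
    (h : ∀ ε > 0, ∀ᶠ n in atTop, SkorokhodClose ε K (γ n) (F n).1 f.1) {s t : ℝ≥0} (hst : s ≤ t)
    (ht : t ≤ K) (hbdd : ∀ r ∈ Set.Ico s t, f.1 r ≤ a) (hsup : sSup (f.1 '' Set.Ico s t) < a) :
    ∀ᶠ n in atTop, aboveTime a (F n).1 (γ n t) = aboveTime a (F n).1 (γ n s) := by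
  filter_upwards [h _ (sub_pos.2 hsup)] with n hn
  refine aboveTime_eq_of_le ((γ n).monotone hst) fun r hr => ?_
  have hr1 : (γ n).symm r ∈ Set.Ico s t :=
    ⟨(OrderIso.le_symm_apply _).2 hr.1, (OrderIso.symm_apply_lt _).2 hr.2⟩
  have hr2 := (hn _ (hr1.2.le.trans ht)).2
  rw [OrderIso.apply_symm_apply, Real.dist_eq, abs_le] at hr2
  have hr3 : f.1 ((γ n).symm r) ≤ sSup (f.1 '' Set.Ico s t) := by
    refine le_csSup ⟨a, ?_⟩ ⟨_, hr1, rfl⟩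
    rintro _ ⟨z, hz, rfl⟩
    exact hbdd z hz
  linarith [hr2.2]

/-- Along a chain of intervals of small oscillation, the fast-forwarded paths are matched up to the
beginning `τ` of the current excursion below a level slightly above `a`. -/
theorem exists_matched_of_chain
    (h : ∀ ε > 0, ∀ᶠ n in atTop, SkorokhodClose ε K (γ n) (F n).1 f.1)
    (hnull : leb {t : ℝ≥0 | f.1 t = a} = 0) (hNl : ConditionNl a f.1) {ε : ℝ} (hε : 0 < ε)
    (hf : a + 4 * ε < f.1 0) {t : ℝ≥0}
    (hchain : Relation.ReflTransGen
      (fun s t : ℝ≥0 => s < t ∧ ∀ r ∈ Set.Ico s t, |f.1 r - f.1 s| < ε) 0 t) (htK : t ≤ K) :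
    ∃ τ ≤ t, (∀ᶠ n in atTop, MatchedUpTo (5 * ε) (aboveTime a f.1 τ)
        (aboveTime a (F n).1 (γ n τ)) (leftFastForward a (F n)) (leftFastForward a f)) ∧
      (∀ r ∈ Set.Ico τ t, f.1 r ≤ a + 4 * ε) ∧
      (τ = 0 ∨ ∃ τ' < τ, ∀ r ∈ Set.Ico τ' τ, a + ε ≤ f.1 r) := by
  induction hchain with
  | refl =>
    refine ⟨0, le_rfl, Eventually.of_forall fun n => ?_, by simp, Or.inl rfl⟩
    rw [← bot_eq_zero, OrderIso.map_bot, bot_eq_zero, aboveTime_zero, aboveTime_zero]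
    exact ⟨OrderIso.refl _, rfl, fun t ht => absurd ht not_lt_zero⟩
  | @tail s t _ hst ih =>
    obtain ⟨hst, hosc⟩ := hst
    have hsK := hst.le.trans htK
    obtain ⟨τ, hτs, hm, hlow, hleft⟩ := ih hsK
    -- With oscillation below ε, a start at most a + 3ε keeps the interval under a + 4ε and prolongs
    -- the excursion; a higher start keeps it above a + 2ε and ends the excursion at s.
    rcases le_or_gt (f.1 s) (a + 3 * ε) with hs | hs
    · refine ⟨τ, hτs.trans hst.le, hm, fun r hr => ?_, hleft⟩
      rcases lt_or_ge r s with hrs | hrs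
      · exact hlow r ⟨hr.1, hrs⟩
      · linarith [(abs_lt.1 (hosc r ⟨hrs, hr.2⟩)).2]
    · have hhigh : ∀ r ∈ Set.Ico s t, a + ε ≤ f.1 r := fun r hr => by
        linarith [(abs_lt.1 (hosc r hr)).1]
      have hms : ∀ᶠ n in atTop, MatchedUpTo (5 * ε) (aboveTime a f.1 s)
          (aboveTime a (F n).1 (γ n s)) (leftFastForward a (F n)) (leftFastForward a f) := by
        rcases (aboveTime_mono a f.1 hτs).lt_or_eq with hA | hA
        · exact eventually_matchedUpTo_extend h hnull hε hτs hsK hA (Or.inl le_rfl) hlow hm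
        · rcases hτs.eq_or_lt with rfl | hlt
          · exact hm
          -- The clock of f does not advance over [τ,s), so there is no piece to match; the clock of
          -- `F n` must be shown not to advance either.
          have hbelow : ∀ r ∈ Set.Ico τ s, f.1 r ≤ a := fun r hr => by
            by_contra! hr'
            exact hA.not_lt (aboveTime_lt hr hr')
          -- An excursion from time 0 contradicts f(0) > a; any other has high stretches on both
          -- sides, as (Nl) requires.
          rcases hleft with rfl | ⟨τ', hτ', hl⟩
          · linarith [hbelow 0 ⟨le_rfl, hlt⟩]
          have hsup := hNl ε hε τ' τ s t hτ' hlt hst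
            (fun r hr => hr.elim (hl r) (hhigh r)) hbelow
          filter_upwards [hm, eventually_aboveTime_eq h hτs hsK hbelow hsup] with n h1 h2
          rwa [← hA, h2]
      refine ⟨t, le_rfl, ?_, by simp, Or.inr ⟨s, hst, hhigh⟩⟩
      refine eventually_matchedUpTo_extend (lo := f.1 s - ε) h hnull hε hst.le htK
        (aboveTime_lt ⟨le_rfl, hst⟩ (by linarith)) (Or.inr fun r hr => ?_) (fun r hr => ?_) hms
      · linarith [(abs_lt.1 (hosc r hr)).1]
      · linarith [(abs_lt.1 (hosc r hr)).2]

theorem continuousAt_leftFastForward (hf : a < f.1 0) (hNl : ConditionNl a f.1)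
    (hnull : leb {t : ℝ≥0 | f.1 t = a} = 0) : ContinuousAt (leftFastForward a) f := by
  refine tendsto_of_seq_tendsto fun F hF => tendsto_of_skorokhodClose fun T δ hδ => ?_
  obtain ⟨K, hK⟩ := exists_lt_aboveTime f T
  obtain ⟨γ, hγ⟩ := exists_orderIso_of_tendsto (tendsto_subtype_rng.1 hF) K
  -- The first term turns the error 5ε into δ; the second puts f(0) above a + 4ε.
  set ε : ℝ := min (δ / 5) ((f.1 0 - a) / 5) with hε
  have hfa : 0 < f.1 0 - a := sub_pos.2 hf
  have hεpos : 0 < ε := by positivity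
  have hε1 : 5 * ε ≤ δ := by linarith [min_le_left (δ / 5) ((f.1 0 - a) / 5)]
  have hε2 : a + 4 * ε < f.1 0 := by linarith [min_le_right (δ / 5) ((f.1 0 - a) / 5)]
  have hmain : ∃ s, T < aboveTime a f.1 s ∧ ∀ᶠ n in atTop, MatchedUpTo (5 * ε)
      (aboveTime a f.1 s) (aboveTime a (F n).1 (γ n s)) (leftFastForward a (F n))
      (leftFastForward a f) := by
    obtain ⟨τ, hτK, hm, hlow, -⟩ := exists_matched_of_chain hγ hnull hNl hεpos hε2
      (f.1.exists_chain hεpos K) le_rfl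
    -- The last excursion may be unfinished at K: either the clock advances on it and it is matched
    -- as it stands, or the clock already exceeds T at τ.
    rcases (aboveTime_mono a f.1 hτK).lt_or_eq with hA | hA
    · exact ⟨K, hK, eventually_matchedUpTo_extend hγ hnull hεpos hτK le_rfl hA (Or.inl le_rfl)
        hlow hm⟩
    · exact ⟨τ, hA ▸ hK, hm⟩
  obtain ⟨s, hs, hm⟩ := hmain
  filter_upwards [hm] with n hn
  obtain ⟨η, -, hη⟩ := hn
  refine ⟨η, fun t ht => ?_⟩
  have := hη t (ht.trans_lt hs)
  exact ⟨this.1.trans hε1, this.2.trans hε1⟩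

end Sufficiency

theorem theorem3p1 (a : ℝ) (f : CadlagPathAbove a) (hf : a < f.1 0) :
    ContinuousAt (leftFastForward a) f ↔
      ConditionNl a f.1 ∧ leb {t : ℝ≥0 | f.1 t = a} = 0 :=
  ⟨fun h => ⟨conditionNl_of_continuousAt h, leb_level_eq_zero_of_continuousAt h⟩,
    fun h => continuousAt_leftFastForward hf h.1 h.2⟩
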